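/- Let $R$ be a (linearly) ordered commutative ring such that (i) $R$ is a principal ideal domain; (ii) $R$ is densely ordered; (iii) for every prime $\pi\in R$, the ideal $\pi R$ is dense in $R$; (iv) for every prime $\pi\in R$, the quotient $R/\pi R$ is infinite. (A subset $S$ of a linearly ordered set $M$ is dense in $M$ if for all $a<b$ in $M$ there is $c\in S$ with $a<c<b$.) An ordered $R$-module is an $R$-module $M$ with a linear order making $M$ an ordered abelian group and such that $r\cdot m>0$ for all $r>0$ in $R$ and $m>0$ in $M$. Ordered $R$-modules are structures in the language $\mathcal L=\{0,+,<\}\cup\{\lambda_r \mid r\in R\}$, where $\lambda_r$ is a unary function symbol interpreted as scalar multiplication by $r$. Let $T$ be the complete $\mathcal L$-theory of $R$, considered as an ordered module over itself. Then: (1) A non-zero ordered $R$-module $M$ is a model of $T$ if and only if, for every prime $\pi\in R$, (a) $\pi M$ is dense in $M$, and (b) $M/\pi M$ is infinite. (2) $T$ eliminates quantifiers in the language $\mathcal L\cup\{P_r \mid r\in R\}$, where the unary predicates $P_r$ are defined by $P_r(x) :\Leftrightarrow \exists y\,(r\cdot y=x)$: modulo $T$ and these definitions, every formula in finitely many free variables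 is equivalent to a quantifier-free formula in the same variables. (3) $T$ is NIP: for every $\mathcal L$-formula $\varphi(x,y)$ with $x,y$ finite tuples of variables, there are no model $N$ of $T$ and tuples $(a_i)_{i\in\mathbb N}$, $(b_s)_{s\subseteq\mathbb N}$ from $N$ such that, for all $i\in\mathbb N$ and $s\subseteq\mathbb N$, $N\models\varphi(a_i,b_s)$ if and only if $i\in s$. -/

import Mathlib

open FirstOrder FirstOrder.Language

universe u v w

namespace OrdMod

/-- Function symbols `0`, `+` and `λ_r` (`r ∈ R`) of the language of ordered `R`-modules. -/
inductive Func (R : Type u) : ℕ → Type u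
  | zero : Func R 0
  | add : Func R 2
  | smul (r : R) : Func R 1

/-- The relation symbol `<`. -/
inductive Rel : ℕ → Type
  | lt : Rel 2

/-- The language `{0, +, <} ∪ {λ_r | r ∈ R}` of ordered `R`-modules. -/
def lang (R : Type u) : FirstOrder.Language.{u, 0} := ⟨Func R, Rel⟩

/-- The unary relation symbols `P_r` (`r ∈ R`). -/
inductive DivRel (R : Type u) : ℕ → Type u
  | dvd (r : R) : DivRel R 1

/-- The language `{P_r | r ∈ R}` of divisibility predicates. -/
def divLang (R : Type u) : FirstOrder.Language.{0, u} := ⟨fun _ => Empty, DivRel R⟩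

/-- The language `{0, +, <} ∪ {λ_r | r ∈ R} ∪ {P_r | r ∈ R}`. -/
abbrev langP (R : Type u) : FirstOrder.Language.{u, u} := (lang R).sum (divLang R)

/-- The standard interpretation: `λ_r` is scalar multiplication by `r`. -/
instance interp (R : Type u) (M : Type v) [Zero M] [Add M] [LT M] [SMul R M] :
    (lang R).Structure M where
  funMap {_} f x :=
    match f with
    | Func.zero => 0
    | Func.add => x 0 + x 1
    | Func.smul r => r • x 0
  RelMap {_} s x :=
    match s with
    | Rel.lt => x 0 < x 1

/-- The theory of `R`, as an ordered module over itself. -/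
def theory (R : Type u) [Ring R] [LT R] : (lang R).Theory := (lang R).completeTheory R

/-- The function symbol `λ_r` in the larger language. -/
def lamP {R : Type u} (r : R) : (langP R).Functions 1 := Sum.inl (Func.smul r)

/-- The relation symbol `P_r` in the larger language. -/
def divP {R : Type u} (r : R) : (langP R).Relations 1 := Sum.inr (DivRel.dvd r)

/-- The sentence `∀ x, P_r(x) ↔ ∃ y, r • y = x`. -/
def divAxiom {R : Type u} (r : R) : (langP R).Sentence :=
  ∀' (((divP r).boundedFormula₁ (&0)).iff (∃' (((lamP r).apply₁ (&1)) =' (&0))))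

/-- The theory of `R`, expanded to the larger language by the definitions of the predicates `P_r`. -/
def theoryP (R : Type u) [Ring R] [LT R] : (langP R).Theory :=
  LHom.sumInl.onTheory (theory R) ∪ Set.range (divAxiom (R := R))

/-- `S` is (order-)dense in `M`: it meets every open interval `(a, b)` with `a < b`. -/
def DenseIn {M : Type v} [LT M] (S : Set M) : Prop :=
  ∀ a b : M, a < b → ∃ c ∈ S, a < c ∧ c < b

/-- The submodule `rM` of `M`. -/
def mulSub {R : Type u} [CommRing R] (r : R) (M : Type v) [AddCommGroup M] [Module R M] :
    Submodule R M :=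
  LinearMap.range (LinearMap.lsmul R M r)

/-- `T` eliminates quantifiers: modulo `T`, every formula in finitely many variables is
equivalent to a quantifier-free formula in the same variables. -/
def ElimQuantifiers {L : FirstOrder.Language.{u, v}} (T : L.Theory) : Prop :=
  ∀ (n : ℕ) (φ : L.Formula (Fin n)),
    ∃ ψ : L.Formula (Fin n), BoundedFormula.IsQF ψ ∧ T ⊨ᵇ φ.iff ψ

/-- The partitioned formula `φ(x; y)` has the independence property in the structure `M`. -/
def HasIP {L : FirstOrder.Language.{u, v}} (M : Type w) [L.Structure M] {m n : ℕ}
    (φ : L.Formula (Fin m ⊕ Fin n)) : Prop :=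
  ∃ (a : ℕ → Fin m → M) (b : Set ℕ → Fin n → M),
    ∀ (i : ℕ) (s : Set ℕ), φ.Realize (Sum.elim (a i) (b s)) ↔ i ∈ s

/-- `T` is NIP: no partitioned formula has the independence property in a model of `T`. -/
def IsNIP {L : FirstOrder.Language.{u, v}} (T : L.Theory) : Prop :=
  ∀ (M : Theory.ModelType.{u, v, max u v} T) (m n : ℕ) (φ : L.Formula (Fin m ⊕ Fin n)),
    ¬ HasIP M φ

end OrdMod

/-!
Write `R` for the ring and call a non-zero ordered `R`-module `M` dense if, for every prime `p`,
`pM` is dense in `M` and `M ⧸ pM` is infinite; the hypotheses say that `R` itself is dense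
(`isDenseModule_self`). The three conjuncts rest on one statement: for two dense modules `M` and
`M'`, each formula `φ` has a finite set `G` of atomic conditions `0 < ∑ c_j x_j` and
`∑ c_j x_j ∈ rM` such that tuples of `M` and `M'` satisfying the same conditions from `G` agree about `φ`
(`exists_finite_forall_agree`). The proof is by induction on `φ`, and the quantifier step is a
back-and-forth argument.

For that step, given `z` in `M` and corresponding parameters `a i` in `M` and `a' i` in `M'`, one
has to find `z'` in `M'` with the same order relations to the parameters and the same congruences
modulo finitely many `rM` (`IsDenseModule.exists_matching`). If `z` is a parameter, so is `z'`.
Otherwise, the congruences true of `z` are pairwise compatible, hence so are their counterparts in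
`M'`, where the Chinese remainder theorem over a Bézout domain gives a coset of `LM'` of
solutions, `L` being the least common multiple of the moduli. A congruence modulo `s` which fails
at `z` fails on all of this coset if `s ∣ L`, by a distributive law for the submodules `rM`. If
`s ∤ L` and `s ≠ 0`, it fails outside one coset of a submodule of infinite index, as `M' ⧸ pM'` is
infinite for a prime `p`; by B. H. Neumann's lemma finitely many such cosets do not cover.
Finally, the congruences are not affected by adding elements of `NM'` for a suitable `N ≠ 0`, and
density of `NM'` gives a solution in the prescribed interval.

For the first conjunct, take empty tuples, which always agree: dense modules are elementarily
equivalent to `R`; conversely, density of `pM` and finiteness of `M ⧸ pM` are expressed by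
formulas. For quantifier elimination, take `M = M' = R`. A condition on tuples that depends only
on `G` is a Boolean combination of atomic formulas, and the resulting equivalence passes from `R`
to all models because the predicates `P_r` can be replaced by their definitions. For NIP, a
formula with the independence property in a model would cut out all `2 ^ k` subsets of some set of
`k` tuples of `R`, for every `k`. But each atomic condition cuts out at most `k + 1` subsets,
which leaves at most `(k + 1) ^ |G|`.
-/

namespace OrdMod

/-! ### Multiples in modules over a principal ideal domain -/

section Multiples

variable {R : Type u} [CommRing R] {M : Type v} [AddCommGroup M] [Module R M]

theorem mem_mulSub {r : R} {x : M} : x ∈ mulSub r M ↔ ∃ y, r • y = x := by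
  simp [mulSub]

theorem smul_mem_mulSub_of_dvd {r s : R} (h : r ∣ s) (x : M) : s • x ∈ mulSub r M := by
  obtain ⟨t, rfl⟩ := h
  exact mem_mulSub.2 ⟨t • x, by rw [mul_smul]⟩

theorem mulSub_le_of_dvd {r s : R} (h : r ∣ s) : mulSub s M ≤ mulSub r M := by
  intro x hx
  obtain ⟨y, rfl⟩ := mem_mulSub.1 hx
  exact smul_mem_mulSub_of_dvd h y

theorem mulSub_zero : mulSub (0 : R) M = ⊥ := by
  ext x
  simp [mem_mulSub, eq_comm]

theorem mulSub_sup [IsBezout R] (r s : R) :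
    mulSub r M ⊔ mulSub s M = mulSub (IsBezout.gcd r s) M := by
  apply le_antisymm
  · exact sup_le (mulSub_le_of_dvd (IsBezout.gcd_dvd_left r s))
      (mulSub_le_of_dvd (IsBezout.gcd_dvd_right r s))
  · intro x hx
    obtain ⟨y, rfl⟩ := mem_mulSub.1 hx
    obtain ⟨a, b, hab⟩ := IsBezout.gcd_eq_sum r s
    rw [← hab, add_smul]
    exact Submodule.add_mem_sup (smul_mem_mulSub_of_dvd (dvd_mul_left _ _) y)
      (smul_mem_mulSub_of_dvd (dvd_mul_left _ _) y)

theorem coe_span_singleton (p : R) : (Ideal.span {p} : Set R) = (mulSub p R : Set R) := by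
  ext x
  simp [mem_mulSub, Ideal.mem_span_singleton, dvd_def, eq_comm]

/-- Division by the greatest common divisor, with Bézout coefficients. -/
theorem exists_coprime_factors [IsDomain R] [IsBezout R] (r s : R) (hr : r ≠ 0) :
    ∃ g r' s' a b : R, g ≠ 0 ∧ r = g * r' ∧ s = g * s' ∧ a * r' + b * s' = 1 := by
  obtain ⟨a, b, hab⟩ := IsBezout.gcd_eq_sum r s
  obtain ⟨r', hr'⟩ := IsBezout.gcd_dvd_left r s
  obtain ⟨s', hs'⟩ := IsBezout.gcd_dvd_right r s
  have hg : IsBezout.gcd r s ≠ 0 := by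
    intro h
    rw [h, zero_mul] at hr'
    exact hr hr'
  refine ⟨_, r', s', a, b, hg, hr', hs', mul_left_cancel₀ hg ?_⟩
  calc IsBezout.gcd r s * (a * r' + b * s')
      = a * (IsBezout.gcd r s * r') + b * (IsBezout.gcd r s * s') := by ring
    _ = a * r + b * s := by rw [← hr', ← hs']
    _ = _ := by rw [hab, mul_one]

/-- Finitely many non-zero elements have a common multiple `L` (their least one) such
that the cofactors `e` with `L ∣ e * r` for some `r` in the family generate the unit ideal. The
generator `e = L` is allowed to cover the empty family. -/
theorem exists_lcm [IsDomain R] [IsBezout R] {S : Set R} (hS : S.Finite) (h0 : 0 ∉ S) :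
    ∃ L : R, (∀ r ∈ S, r ∣ L) ∧
      Ideal.span {e : R | L ∣ e ∨ ∃ r ∈ S, L ∣ e * r} = ⊤ := by
  induction S, hS using Set.Finite.induction_on with
  | empty =>
    refine ⟨1, by simp, ?_⟩
    rw [Ideal.eq_top_iff_one]
    exact Ideal.subset_span (Or.inl dvd_rfl)
  | @insert r S _ _ ih =>
    obtain ⟨L, hdvd, htop⟩ := ih fun h => h0 (Set.mem_insert_of_mem _ h)
    have hr : r ≠ 0 := fun h => h0 (h ▸ Set.mem_insert _ _)
    obtain ⟨g, r', L', a, b, hg, rfl, rfl, hab⟩ := exists_coprime_factors r L hr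
    refine ⟨g * L' * r', ?_, ?_⟩
    · intro s hs
      rcases Set.mem_insert_iff.1 hs with rfl | hs
      · exact ⟨L', by ring⟩
      · exact (hdvd s hs).mul_right _
    · set J := Ideal.span {e : R | g * L' * r' ∣ e ∨ ∃ s ∈ insert (g * r') S, g * L' * r' ∣ e * s}
        with hJ
      have h1 : L' ∈ J := Ideal.subset_span
        (Or.inr ⟨g * r', Set.mem_insert _ _, ⟨1, by ring⟩⟩)
      have h2 : ∀ e ∈ Ideal.span {e : R | g * L' ∣ e ∨ ∃ s ∈ S, g * L' ∣ e * s},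
          e * r' ∈ J := by
        intro e he
        have hle : Ideal.span {e : R | g * L' ∣ e ∨ ∃ s ∈ S, g * L' ∣ e * s} ≤
            Submodule.comap (LinearMap.mulRight R r') J := by
          rw [Ideal.span, Submodule.span_le]
          rintro e (he | ⟨s, hs, he⟩)
          · exact Ideal.subset_span (Or.inl (mul_dvd_mul_right he r'))
          · refine Ideal.subset_span (Or.inr ⟨s, Set.mem_insert_of_mem _ hs, ?_⟩)
            change _ ∣ e * r' * s
            rw [mul_right_comm e]
            exact mul_dvd_mul_right he r'
        exact hle he
      have h3 : r' ∈ J := by simpa using h2 1 (by rw [htop]; trivial)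
      rw [Ideal.eq_top_iff_one, ← hab]
      exact J.add_mem (J.mul_mem_left _ h3) (J.mul_mem_left _ h1)

/-- A distributive law: `⋂ (rM + tM) ≤ LM + tM`, where `L` is the least common multiple of the
elements `r`. -/
theorem mem_sup_of_forall_mem_sup {S : Set R} {L : R}
    (hL : Ideal.span {e : R | L ∣ e ∨ ∃ r ∈ S, L ∣ e * r} = ⊤) {t : R} {x : M}
    (hx : ∀ r ∈ S, x ∈ mulSub r M ⊔ mulSub t M) : x ∈ mulSub L M ⊔ mulSub t M := by
  have hle : Ideal.span {e : R | L ∣ e ∨ ∃ r ∈ S, L ∣ e * r} ≤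
      Submodule.comap (LinearMap.toSpanSingleton R M x) (mulSub L M ⊔ mulSub t M) := by
    rw [Ideal.span, Submodule.span_le]
    rintro e (he | ⟨r, hr, he⟩)
    · exact Submodule.mem_sup_left (smul_mem_mulSub_of_dvd he x)
    · obtain ⟨y, hy, z, hz, rfl⟩ := Submodule.mem_sup.1 (hx r hr)
      change e • (y + z) ∈ mulSub L M ⊔ mulSub t M
      obtain ⟨y, rfl⟩ := mem_mulSub.1 hy
      rw [smul_add, ← mul_smul]
      exact Submodule.add_mem_sup (smul_mem_mulSub_of_dvd he y) (Submodule.smul_mem _ _ hz)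
  have h1 : (1 : R) ∈ Ideal.span {e : R | L ∣ e ∨ ∃ r ∈ S, L ∣ e * r} := by rw [hL]; trivial
  simpa using hle h1

/-- The Chinese remainder theorem for pairwise compatible congruences `z ≡ b mod rM`,
`(b, r) ∈ I`, with arbitrary non-zero moduli. -/
theorem exists_forall_sub_mem [IsDomain R] [IsBezout R] {I : Set (M × R)} (hI : I.Finite)
    (h0 : ∀ c ∈ I, c.2 ≠ 0)
    (hcomp : ∀ c ∈ I, ∀ d ∈ I, c.1 - d.1 ∈ mulSub c.2 M ⊔ mulSub d.2 M) :
    ∃ z : M, ∀ c ∈ I, z - c.1 ∈ mulSub c.2 M := by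
  induction I, hI using Set.Finite.induction_on with
  | empty => exact ⟨0, by simp⟩
  | @insert c I _ hI ih =>
    obtain ⟨z, hz⟩ := ih (fun d hd => h0 d (Set.mem_insert_of_mem _ hd))
      fun d hd e he => hcomp d (Set.mem_insert_of_mem _ hd) e (Set.mem_insert_of_mem _ he)
    obtain ⟨L, hdvd, htop⟩ := exists_lcm (S := Prod.snd '' I) (hI.image _) <| by
      rintro ⟨d, hd, h⟩
      exact h0 d (Set.mem_insert_of_mem _ hd) h
    have hzc : z - c.1 ∈ mulSub L M ⊔ mulSub c.2 M := by
      refine mem_sup_of_forall_mem_sup htop ?_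
      rintro _ ⟨d, hd, rfl⟩
      rw [← sub_add_sub_cancel z d.1 c.1]
      exact add_mem (Submodule.mem_sup_left (hz d hd))
        (hcomp d (Set.mem_insert_of_mem _ hd) c (Set.mem_insert _ _))
    obtain ⟨x, hx, y, hy, hxy⟩ := Submodule.mem_sup.1 hzc
    refine ⟨z - x, fun d hd => ?_⟩
    rcases Set.mem_insert_iff.1 hd with rfl | hd
    · rw [sub_right_comm, ← hxy, add_sub_cancel_left]
      exact hy
    · rw [sub_right_comm]
      exact sub_mem (hz d hd) (mulSub_le_of_dvd (hdvd _ ⟨d, hd, rfl⟩) hx)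

end Multiples

/-! ### Dense ordered modules -/

/-- The algebraic conditions that characterise the models of the theory of `R`: multiplication by
positive scalars preserves positivity and, for every prime `p`, `pM` is dense in `M` and `M ⧸ pM` is
infinite. -/
structure IsDenseModule (R : Type u) [CommRing R] [LT R] (M : Type v) [AddCommGroup M] [LT M]
    [Module R M] : Prop where
  smul_pos : ∀ (r : R) (m : M), 0 < r → 0 < m → 0 < r • m
  dense : ∀ p : R, Prime p → DenseIn (mulSub p M : Set M)
  infinite : ∀ p : R, Prime p → Infinite (M ⧸ mulSub p M)

namespace IsDenseModule

section Single

variable {R : Type u} [CommRing R] [LinearOrder R]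
  {M : Type v} [AddCommGroup M] [LinearOrder M] [IsOrderedAddMonoid M] [Module R M]

theorem smul_lt_smul_iff (hM : IsDenseModule R M) {r : R} (hr : 0 < r) {x y : M} :
    r • x < r • y ↔ x < y := by
  have hlt : ∀ {x y : M}, x < y → r • x < r • y := fun {x y} h => by
    rw [← sub_pos, ← smul_sub]
    exact hM.smul_pos _ _ hr (sub_pos.2 h)
  refine ⟨fun h => ?_, hlt⟩
  rcases lt_trichotomy x y with h' | rfl | h'
  · exact h'
  · exact absurd h (lt_irrefl _)
  · exact absurd h (hlt h').asymm

variable [IsStrictOrderedRing R]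

theorem smul_lt_smul_iff_of_neg (hM : IsDenseModule R M) {r : R} (hr : r < 0) {x y : M} :
    r • x < r • y ↔ y < x := by
  rw [← neg_lt_neg_iff, ← neg_smul, ← neg_smul, hM.smul_lt_smul_iff (neg_pos.2 hr)]

theorem smul_left_cancel (hM : IsDenseModule R M) {r : R} (hr : r ≠ 0) {x y : M}
    (h : r • x = r • y) : x = y := by
  by_contra hne
  rcases lt_or_gt_of_ne hr with hr | hr <;> rcases lt_or_gt_of_ne hne with h' | h'
  · exact ((hM.smul_lt_smul_iff_of_neg hr).2 h').ne' h
  · exact ((hM.smul_lt_smul_iff_of_neg hr).2 h').ne h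
  · exact ((hM.smul_lt_smul_iff hr).2 h').ne h
  · exact ((hM.smul_lt_smul_iff hr).2 h').ne' h

theorem smul_mem_mulSub_mul_iff (hM : IsDenseModule R M) {d r : R} (hd : d ≠ 0) {x : M} :
    d • x ∈ mulSub (d * r) M ↔ x ∈ mulSub r M := by
  simp only [mem_mulSub, mul_smul]
  exact ⟨fun ⟨y, hy⟩ => ⟨y, hM.smul_left_cancel hd hy⟩, fun ⟨y, hy⟩ => ⟨y, by rw [hy]⟩⟩

theorem denselyOrdered [DenselyOrdered R] (hM : IsDenseModule R M) : DenselyOrdered M := by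
  refine ⟨fun a b hab => ?_⟩
  obtain ⟨r, h0, h1⟩ := exists_between (zero_lt_one' R)
  have hpos := sub_pos.2 hab
  refine ⟨a + r • (b - a), lt_add_of_pos_right a (hM.smul_pos r _ h0 hpos), ?_⟩
  rw [← lt_sub_iff_add_lt', ← sub_pos]
  have := hM.smul_pos (1 - r) _ (sub_pos.2 h1) hpos
  rwa [sub_smul, one_smul] at this

theorem denseIn_mulSub [IsPrincipalIdealRing R] [DenselyOrdered R]
    (hM : IsDenseModule R M) {r : R} (hr : r ≠ 0) : DenseIn (mulSub r M : Set M) := by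
  have := hM.denselyOrdered
  revert hr
  refine UniqueFactorizationMonoid.induction_on_prime r (fun h => absurd rfl h) ?_ ?_
  · intro x hx _ a b hab
    obtain ⟨c, hc⟩ := exists_between hab
    refine ⟨c, ?_, hc⟩
    have := smul_mem_mulSub_of_dvd (hx.dvd (a := 1)) c
    rwa [one_smul] at this
  · intro s p hs hp ih _ a b hab
    obtain ⟨c, hc, hac, hcb⟩ := hM.dense p hp a b hab
    obtain ⟨d, hd, hcd, hdb⟩ := hM.dense p hp c b hcb
    obtain ⟨x, rfl⟩ := mem_mulSub.1 hc
    obtain ⟨y, rfl⟩ := mem_mulSub.1 hd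
    have key : ∃ z, p • x < p • (s • z) ∧ p • (s • z) < p • y := by
      rcases lt_or_gt_of_ne hp.ne_zero with hp0 | hp0
      · rw [hM.smul_lt_smul_iff_of_neg hp0] at hcd
        obtain ⟨e, he, h1, h2⟩ := ih hs _ _ hcd
        obtain ⟨z, rfl⟩ := mem_mulSub.1 he
        exact ⟨z, (hM.smul_lt_smul_iff_of_neg hp0).2 h2, (hM.smul_lt_smul_iff_of_neg hp0).2 h1⟩
      · rw [hM.smul_lt_smul_iff hp0] at hcd
        obtain ⟨e, he, h1, h2⟩ := ih hs _ _ hcd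
        obtain ⟨z, rfl⟩ := mem_mulSub.1 he
        exact ⟨z, (hM.smul_lt_smul_iff hp0).2 h1, (hM.smul_lt_smul_iff hp0).2 h2⟩
    obtain ⟨z, h1, h2⟩ := key
    refine ⟨p • s • z, mem_mulSub.2 ⟨z, mul_smul _ _ _⟩, hac.trans h1, h2.trans hdb⟩

/-- If `s` does not divide `L`, then `{x | L • x ∈ sM}` lies in `pM` for some prime `p`, whence
it has infinite index. -/
theorem not_finiteIndex_comap [IsPrincipalIdealRing R] (hM : IsDenseModule R M)
    {L s : R} (hs : s ≠ 0) (h : ¬ s ∣ L) :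
    ¬ ((mulSub s M).comap (LinearMap.lsmul R M L)).toAddSubgroup.FiniteIndex := by
  obtain ⟨g, s', L', a, b, hg, rfl, rfl, hab⟩ := exists_coprime_factors s L hs
  have hunit : ¬ IsUnit s' := fun hu => h (mul_dvd_mul_left g (hu.dvd))
  obtain ⟨p, hp, t, rfl⟩ := WfDvdMonoid.exists_irreducible_factor hunit (right_ne_zero_of_mul hs)
  intro hfin
  have hle : ((mulSub (g * (p * t)) M).comap (LinearMap.lsmul R M (g * L'))).toAddSubgroup ≤
      (mulSub p M).toAddSubgroup := by
    intro x hx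
    obtain ⟨y, hy⟩ := mem_mulSub.1 (show (g * L') • x ∈ mulSub (g * (p * t)) M from hx)
    rw [mul_smul, mul_smul g L'] at hy
    have hy := hM.smul_left_cancel hg hy
    have hx : x = p • (a • t • x + b • t • y) := by
      calc x = (a * (p * t) + b * L') • x := by rw [hab, one_smul]
        _ = _ := by
          rw [add_smul, mul_smul b, ← hy]
          module
    exact mem_mulSub.2 ⟨_, hx.symm⟩
  have := AddSubgroup.finiteIndex_of_le hle
  have hinf := hM.infinite p hp.prime
  have hfin : Finite (M ⧸ (mulSub p M).toAddSubgroup) := AddSubgroup.finite_quotient_of_finiteIndex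
  exact hinf.not_finite hfin

open scoped Pointwise in
/-- By B. H. Neumann's lemma, a coset of `LM` is not covered by finitely many cosets of submodules
`sM` with `s ∤ L`. -/
theorem exists_smul_sub_notMem [IsPrincipalIdealRing R] (hM : IsDenseModule R M)
    {L : R} {J : Set (M × R)} (hJ : J.Finite) (h0 : ∀ c ∈ J, c.2 ≠ 0) (hL : ∀ c ∈ J, ¬ c.2 ∣ L) :
    ∃ x : M, ∀ c ∈ J, L • x - c.1 ∉ mulSub c.2 M := by
  classical
  by_contra! hcon
  let H : M × R → AddSubgroup M := fun c =>
    ((mulSub c.2 M).comap (LinearMap.lsmul R M L)).toAddSubgroup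
  -- Each non-empty set `{x | L • x - c.1 ∈ c.2 M}` is the coset of `H c` through `g c`.
  have hg : ∀ c : M × R, ∃ g : M, ∀ x, L • x - c.1 ∈ mulSub c.2 M → -g + x ∈ H c := by
    intro c
    by_cases hc : ∃ g, L • g - c.1 ∈ mulSub c.2 M
    · obtain ⟨g, hg⟩ := hc
      refine ⟨g, fun x hx => ?_⟩
      change L • (-g + x) ∈ mulSub c.2 M
      have := sub_mem hx hg
      rwa [sub_sub_sub_cancel_right, ← smul_sub, sub_eq_neg_add] at this
    · exact ⟨0, fun x hx => absurd ⟨x, hx⟩ hc⟩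
  choose g hg using hg
  have hcov : ⋃ c ∈ hJ.toFinset, g c +ᵥ (H c : Set M) = Set.univ := by
    refine Set.eq_univ_of_forall fun x => ?_
    obtain ⟨c, hc, hx⟩ := hcon x
    simp only [Set.mem_iUnion]
    refine ⟨c, hJ.mem_toFinset.2 hc, ?_⟩
    rw [mem_leftAddCoset_iff]
    exact hg c x hx
  obtain ⟨c, hc, hfin⟩ := AddSubgroup.exists_finiteIndex_of_leftCoset_cover hcov
  have hc := hJ.mem_toFinset.1 hc
  exact hM.not_finiteIndex_comap (h0 c hc) (hL c hc) hfin

end Single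

variable {R : Type u} [CommRing R] [LinearOrder R] [IsStrictOrderedRing R]
  {M : Type v} [AddCommGroup M] [LinearOrder M] [Module R M]
  {M' : Type w} [AddCommGroup M'] [LinearOrder M'] [IsOrderedAddMonoid M'] [Module R M']

/-- The one-point extension property behind quantifier elimination: if the parameters `a` in `M`
and `a'` in `M'` have the same order type and their differences lie in the same submodules
`rM + sM`, then each element of `M` is matched by one of `M'` with the same order relations to the
parameters and the same congruences. -/
theorem exists_matching [IsPrincipalIdealRing R] [DenselyOrdered R] [Nontrivial M']
    (hM' : IsDenseModule R M') {κ : Type*} [Finite κ] {a : κ → M} {a' : κ → M'}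
    {P : Set R} (hP : P.Finite) (hlt : ∀ i j, a i < a j ↔ a' i < a' j)
    (hdvd : ∀ i j, ∀ r ∈ P, ∀ s ∈ P,
      a i - a j ∈ mulSub r M ⊔ mulSub s M ↔ a' i - a' j ∈ mulSub r M' ⊔ mulSub s M') (z : M) :
    ∃ z' : M', ∀ i, (z < a i ↔ z' < a' i) ∧ (a i < z ↔ a' i < z') ∧
      ∀ r ∈ P, (z - a i ∈ mulSub r M ↔ z' - a' i ∈ mulSub r M') := by
  classical
  have := hM'.denselyOrdered
  by_cases hz : ∃ i, z = a i
  · obtain ⟨i, rfl⟩ := hz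
    exact ⟨a' i, fun j => ⟨hlt i j, hlt j i, fun r hr => by simpa using hdvd i j r hr r hr⟩⟩
  push Not at hz
  -- The congruences satisfied by `z`; their moduli are non-zero as `z` is not a parameter.
  let I : Set (κ × R) := {c | c.2 ∈ P ∧ z - a c.1 ∈ mulSub c.2 M}
  have hfin : ∀ T : Set (κ × R), (∀ c ∈ T, c.2 ∈ P) → T.Finite := fun T hT =>
    (Set.finite_univ.prod hP).subset fun c hc => ⟨trivial, hT c hc⟩
  have hI : I.Finite := hfin I fun c hc => hc.1
  have hI0 : ∀ c ∈ I, c.2 ≠ 0 := by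
    rintro c ⟨-, hc⟩ h0
    rw [h0, mulSub_zero, Submodule.mem_bot, sub_eq_zero] at hc
    exact hz _ hc
  obtain ⟨L, hLdvd, hLtop⟩ := exists_lcm (S := Prod.snd '' I) (hI.image _) <| by
    rintro ⟨c, hc, h⟩
    exact hI0 c hc h
  obtain ⟨z₀, hz₀⟩ := exists_forall_sub_mem (M := M') (R := R)
    (I := (fun c => (a' c.1, c.2)) '' I) (hI.image _)
    (by rintro _ ⟨c, hc, rfl⟩; exact hI0 c hc) (by
      rintro _ ⟨c, hc, rfl⟩ _ ⟨d, hd, rfl⟩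
      refine (hdvd _ _ _ hc.1 _ hd.1).1 ?_
      rw [← sub_sub_sub_cancel_left _ _ z]
      exact sub_mem (Submodule.mem_sup_right hd.2) (Submodule.mem_sup_left hc.2))
  replace hz₀ : ∀ c ∈ I, z₀ - a' c.1 ∈ mulSub c.2 M' := fun c hc => hz₀ _ ⟨c, hc, rfl⟩
  -- Congruences failing at `z` whose modulus divides `L` fail on all of `z₀ + LM'`.
  have hneg : ∀ i, ∀ s ∈ P, s ∣ L → z₀ - a' i ∈ mulSub s M' → z - a i ∈ mulSub s M := by
    intro i s hs hsL h
    have : z - a i ∈ mulSub L M ⊔ mulSub s M := by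
      refine mem_sup_of_forall_mem_sup hLtop ?_
      rintro _ ⟨c, hc, rfl⟩
      rw [← sub_add_sub_cancel z (a c.1) (a i)]
      refine add_mem (Submodule.mem_sup_left hc.2) ((hdvd _ _ _ hc.1 _ hs).2 ?_)
      rw [← sub_sub_sub_cancel_left _ _ z₀]
      exact sub_mem (Submodule.mem_sup_right h) (Submodule.mem_sup_left (hz₀ c hc))
    rwa [sup_eq_right.2 (mulSub_le_of_dvd hsL)] at this
  -- Those with non-zero modulus not dividing `L` are avoided by a choice inside `z₀ + LM'`.
  obtain ⟨m, hm⟩ := hM'.exists_smul_sub_notMem (L := L)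
    (J := (fun c : κ × R => (a' c.1 - z₀, c.2)) '' {c | c.2 ∈ P ∧ c.2 ≠ 0 ∧ ¬ c.2 ∣ L})
    ((hfin _ fun c hc => hc.1).image _) (by rintro _ ⟨c, hc, rfl⟩; exact hc.2.1)
    (by rintro _ ⟨c, hc, rfl⟩; exact hc.2.2)
  have hz₁ : ∀ i, ∀ s ∈ P, s ≠ 0 →
      (z - a i ∈ mulSub s M ↔ z₀ + L • m - a' i ∈ mulSub s M') := by
    intro i s hs hs0
    constructor
    · intro h
      rw [add_sub_right_comm]
      exact add_mem (hz₀ (i, s) ⟨hs, h⟩) (smul_mem_mulSub_of_dvd (hLdvd _ ⟨(i, s), ⟨hs, h⟩, rfl⟩) m)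
    · intro h
      by_cases hsL : s ∣ L
      · refine hneg i s hs hsL ?_
        rw [add_sub_right_comm] at h
        exact (Submodule.add_mem_iff_left _ (smul_mem_mulSub_of_dvd hsL m)).1 h
      · refine absurd ?_ (hm _ ⟨(i, s), ⟨hs, hs0, hsL⟩, rfl⟩)
        simpa [sub_sub_eq_add_sub, add_comm] using h
  -- Moving by multiples of the product `N` of all moduli keeps the congruences and is dense.
  let N : R := ∏ s ∈ hP.toFinset with s ≠ 0, s
  have hN0 : N ≠ 0 := Finset.prod_ne_zero_iff.2 fun s hs => (Finset.mem_filter.1 hs).2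
  have hN : ∀ s ∈ P, s ≠ 0 → s ∣ N := fun s hs hs0 =>
    Finset.dvd_prod_of_mem (fun s => s) (Finset.mem_filter.2 ⟨hP.mem_toFinset.2 hs, hs0⟩)
  let lo : Finset M' := ((Set.toFinite {i | a i < z}).image a').toFinset
  let hi : Finset M' := ((Set.toFinite {i | z < a i}).image a').toFinset
  have hlohi : ∀ x ∈ lo, ∀ y ∈ hi, x < y := by
    intro x hx y hy
    obtain ⟨i, hi, rfl⟩ := (Set.Finite.mem_toFinset _).1 hx
    obtain ⟨j, hj, rfl⟩ := (Set.Finite.mem_toFinset _).1 hy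
    exact (hlt i j).1 (lt_trans hi hj)
  obtain ⟨x, hx1, hx2⟩ := Order.exists_between_finsets lo hi hlohi
  -- A second point `y` of the cut leaves an interval `(x, y)` inside it.
  obtain ⟨y, hy1, hy2⟩ := Order.exists_between_finsets {x} hi (by simpa using hx2)
  have hxy : x - (z₀ + L • m) < y - (z₀ + L • m) := sub_lt_sub_right (hy1 x (by simp)) _
  obtain ⟨c, hc, hxc, hcy⟩ := hM'.denseIn_mulSub hN0 _ _ hxy
  obtain ⟨n, rfl⟩ := mem_mulSub.1 hc
  rw [sub_lt_iff_lt_add'] at hxc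
  rw [lt_sub_iff_add_lt'] at hcy
  have hlow : ∀ i, a i < z → a' i < z₀ + L • m + N • n := fun i hi =>
    (hx1 _ ((Set.Finite.mem_toFinset _).2 ⟨i, hi, rfl⟩)).trans hxc
  have hupp : ∀ i, z < a i → z₀ + L • m + N • n < a' i := fun i hi =>
    hcy.trans (hy2 _ ((Set.Finite.mem_toFinset _).2 ⟨i, hi, rfl⟩))
  refine ⟨z₀ + L • m + N • n, fun i => ?_⟩
  rcases lt_or_gt_of_ne (hz i) with h | h
  · refine ⟨iff_of_true h (hupp i h), iff_of_false h.asymm (hupp i h).asymm, fun r hr => ?_⟩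
    -- The congruence modulo `0` is equality, which fails on both sides.
    by_cases hr0 : r = 0
    · simp [hr0, mulSub_zero, sub_eq_zero, hz i, (hupp i h).ne]
    · rw [hz₁ i r hr hr0, add_sub_right_comm _ (N • n),
        Submodule.add_mem_iff_left _ (smul_mem_mulSub_of_dvd (hN r hr hr0) n)]
  · refine ⟨iff_of_false h.asymm (hlow i h).asymm, iff_of_true h (hlow i h), fun r hr => ?_⟩
    by_cases hr0 : r = 0
    · simp [hr0, mulSub_zero, sub_eq_zero, hz i, (hlow i h).ne']
    · rw [hz₁ i r hr hr0, add_sub_right_comm _ (N • n),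
        Submodule.add_mem_iff_left _ (smul_mem_mulSub_of_dvd (hN r hr hr0) n)]

end IsDenseModule

/-! ### Atomic conditions and the elimination of one variable -/

/-- A normalised atomic condition on a tuple `x` of elements of a module: with
`ℓ(x) = ∑ j, c j • x j`, either `0 < ℓ(x)` or `ℓ(x) ∈ rM`. Equality is the case `r = 0` of the
latter. -/
inductive Atom (R : Type u) (V : Type) : Type u
  | pos (c : V → R)
  | dvd (r : R) (c : V → R)

namespace Atom

variable {R : Type u} {V W : Type}

/-- The coefficients of the linear form in an atomic condition. -/
def coeff : Atom R V → V → R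
  | pos c => c
  | dvd _ c => c

/-- The modulus of a divisibility condition (and `0` for an order condition). -/
def modulus [Zero R] : Atom R V → R
  | pos _ => 0
  | dvd r _ => r

/-- Change the linear form of an atomic condition. -/
def mapCoeff (f : (V → R) → W → R) : Atom R V → Atom R W
  | pos c => pos (f c)
  | dvd r c => dvd r (f c)

/-- The truth of an atomic condition at a tuple. -/
def Holds [CommRing R] [Fintype V] {M : Type v} [AddCommGroup M] [LT M] [Module R M]
    (A : Atom R V) (x : V → M) : Prop :=
  match A with
  | pos c => 0 < Fintype.linearCombination R x c
  | dvd r c => Fintype.linearCombination R x c ∈ mulSub r M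

end Atom

/-- Two tuples, possibly from different modules, satisfy the same conditions from `G`. -/
def Agree {R : Type u} [CommRing R] {V : Type} [Fintype V] {M : Type v} [AddCommGroup M] [LT M]
    [Module R M] {M' : Type w} [AddCommGroup M'] [LT M'] [Module R M'] (G : Set (Atom R V))
    (x : V → M) (x' : V → M') : Prop :=
  ∀ A ∈ G, A.Holds x ↔ A.Holds x'

section Agree

variable {R : Type u} [CommRing R] {V : Type} [Fintype V]
  {M : Type v} [AddCommGroup M] [LT M] [Module R M]
  {M' : Type w} [AddCommGroup M'] [LT M'] [Module R M']

theorem Agree.symm {G : Set (Atom R V)} {x : V → M} {x' : V → M'} (h : Agree G x x') :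
    Agree G x' x := fun A hA => (h A hA).symm

theorem Agree.mono {F G : Set (Atom R V)} (hFG : F ⊆ G) {x : V → M} {x' : V → M'}
    (h : Agree G x x') : Agree F x x' := fun A hA => h A (hFG hA)

end Agree

section Snoc

variable {R : Type u} [CommRing R] {α : Type} {n : ℕ}

/-- The part of a linear form not involving the last variable. -/
def initForm (c : α ⊕ Fin (n + 1) → R) : α ⊕ Fin n → R :=
  c ∘ Sum.map id Fin.castSucc

/-- The coefficient of the last variable in a linear form. -/
def lastCoeff (c : α ⊕ Fin (n + 1) → R) : R :=
  c (Sum.inr (Fin.last n))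

theorem linearCombination_snoc [Fintype α] {M : Type v} [AddCommGroup M] [Module R M] (x : α → M)
    (xs : Fin n → M) (y : M) (c : α ⊕ Fin (n + 1) → R) :
    Fintype.linearCombination R (Sum.elim x (Fin.snoc xs y : Fin (n + 1) → M)) c =
      Fintype.linearCombination R (Sum.elim x xs) (initForm c) + lastCoeff c • y := by
  simp [Fintype.linearCombination_apply, Fin.sum_univ_castSucc, initForm, lastCoeff, add_assoc]

end Snoc

section Elimination

variable {R : Type u} [CommRing R] [LinearOrder R] [IsStrictOrderedRing R]
  {α : Type} [Fintype α] {n : ℕ}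

/-- An atomic condition involving the last variable `y` is a condition on `C • y`, if `C` is a
multiple of the coefficient of `y`: multiply by the cofactor `d`. -/
theorem Atom.holds_snoc_iff {M : Type v} [AddCommGroup M] [LinearOrder M] [IsOrderedAddMonoid M]
    [Module R M] (hM : IsDenseModule R M) (A : Atom R (α ⊕ Fin (n + 1))) {C d : R} (hd : d ≠ 0)
    (hC : d * lastCoeff A.coeff = C) (x : α → M) (xs : Fin n → M) (y : M) {b : M}
    (hb : b = Fintype.linearCombination R (Sum.elim x xs) (-(d • initForm A.coeff))) :
    A.Holds (Sum.elim x (Fin.snoc xs y : Fin (n + 1) → M)) ↔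
      match A with
      | .pos _ => if 0 < d then b < C • y else C • y < b
      | .dvd r _ => C • y - b ∈ mulSub (d * r) M := by
  have key : d • Fintype.linearCombination R (Sum.elim x (Fin.snoc xs y : Fin (n + 1) → M)) A.coeff
      = C • y - b := by
    rw [linearCombination_snoc, hb, map_neg, map_smul, ← hC, mul_smul, smul_add, sub_neg_eq_add,
      add_comm]
  cases A with
  | pos c =>
    change 0 < _ ↔ if 0 < d then _ else _
    split_ifs with h
    · rw [← hM.smul_lt_smul_iff h, smul_zero]
      exact key ▸ sub_pos
    · rw [← hM.smul_lt_smul_iff_of_neg (lt_of_le_of_ne (not_lt.1 h) hd), smul_zero]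
      exact key ▸ sub_neg
  | dvd r c =>
    change _ ∈ _ ↔ _ ∈ _
    rw [← hM.smul_mem_mulSub_mul_iff hd]
    exact iff_of_eq (congrArg (· ∈ mulSub (d * r) M) key)

variable [IsPrincipalIdealRing R] [DenselyOrdered R]
  {M : Type v} [AddCommGroup M] [LinearOrder M] [IsOrderedAddMonoid M] [Module R M]
  {M' : Type w} [AddCommGroup M'] [LinearOrder M'] [IsOrderedAddMonoid M'] [Module R M']

/-- The step from `M` to `M'` in the elimination of the last variable. Here `C` is a common
multiple of its non-zero coefficients `c`, and `d c` is the cofactor of `c`. -/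
theorem exists_agree_snoc [Nontrivial M'] (hM : IsDenseModule R M) (hM' : IsDenseModule R M')
    {F : Set (Atom R (α ⊕ Fin (n + 1)))} {G : Set (Atom R (α ⊕ Fin n))} {C : R}
    (hC : C ≠ 0) {d : R → R}
    (hd : ∀ A ∈ F, lastCoeff A.coeff ≠ 0 → d (lastCoeff A.coeff) * lastCoeff A.coeff = C)
    {K : Set (α ⊕ Fin n → R)} (hK : K.Finite) (hK0 : 0 ∈ K)
    (hKF : ∀ A ∈ F, -(d (lastCoeff A.coeff) • initForm A.coeff) ∈ K)
    {P : Set R} (hP : P.Finite) (hPC : C ∈ P)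
    (hPF : ∀ A ∈ F, d (lastCoeff A.coeff) * A.modulus ∈ P)
    (hGF : ∀ A ∈ F, A.mapCoeff initForm ∈ G)
    (hGpos : ∀ a ∈ K, ∀ b ∈ K, Atom.pos (b - a) ∈ G)
    (hGdvd : ∀ a ∈ K, ∀ b ∈ K, ∀ r ∈ P, ∀ s ∈ P, Atom.dvd (IsBezout.gcd r s) (a - b) ∈ G)
    {x : α → M} {xs : Fin n → M} {x' : α → M'} {xs' : Fin n → M'}
    (hG : Agree G (Sum.elim x xs) (Sum.elim x' xs')) (y : M) :
    ∃ y' : M', Agree F (Sum.elim x (Fin.snoc xs y : Fin (n + 1) → M))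
      (Sum.elim x' (Fin.snoc xs' y' : Fin (n + 1) → M')) := by
  have := hK.to_subtype
  obtain ⟨z', hz'⟩ := IsDenseModule.exists_matching hM' (κ := K)
    (a := fun k => Fintype.linearCombination R (Sum.elim x xs) k.1)
    (a' := fun k => Fintype.linearCombination R (Sum.elim x' xs') k.1) hP
    (fun i j => by
      have := hG _ (hGpos i.1 i.2 j.1 j.2)
      simpa [Atom.Holds] using this)
    (fun i j r hr s hs => by
      have := hG _ (hGdvd i.1 i.2 j.1 j.2 r hr s hs)
      rw [mulSub_sup, mulSub_sup, ← map_sub, ← map_sub]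
      exact this) (C • y)
  -- As `0 ∈ K` and `C ∈ P`, the match of `C • y` is again divisible by `C`.
  obtain ⟨y', rfl⟩ : ∃ y', C • y' = z' := by
    have h := (hz' ⟨0, hK0⟩).2.2 C hPC
    simp only [map_zero, sub_zero] at h
    exact mem_mulSub.1 (h.1 (mem_mulSub.2 ⟨y, rfl⟩))
  refine ⟨y', fun A hA => ?_⟩
  by_cases h0 : lastCoeff A.coeff = 0
  · have := hG _ (hGF A hA)
    cases A with
    | pos c =>
      replace h0 : lastCoeff c = 0 := h0
      simpa only [Atom.Holds, Atom.mapCoeff, linearCombination_snoc, h0, zero_smul, add_zero] using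
        this
    | dvd r c =>
      replace h0 : lastCoeff c = 0 := h0
      simpa only [Atom.Holds, Atom.mapCoeff, linearCombination_snoc, h0, zero_smul, add_zero] using
        this
  · have hC' := hd A hA h0
    have hd0 : d (lastCoeff A.coeff) ≠ 0 := fun h => hC (by rw [← hC', h, zero_mul])
    have hmatch := hz' ⟨_, hKF A hA⟩
    rw [A.holds_snoc_iff hM hd0 hC' x xs y rfl, A.holds_snoc_iff hM' hd0 hC' x' xs' y' rfl]
    cases A with
    | pos c =>
      simp only
      split_ifs
      · exact hmatch.2.1
      · exact hmatch.1
    | dvd r c => exact hmatch.2.2 _ (hPF _ hA)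

/-- The back-and-forth property: agreement of two tuples about enough conditions allows elements to
be added on either side so that the extended tuples agree about `F`. -/
theorem exists_finite_agree_snoc [Nontrivial M] [Nontrivial M'] (hM : IsDenseModule R M)
    (hM' : IsDenseModule R M') {F : Set (Atom R (α ⊕ Fin (n + 1)))} (hF : F.Finite) :
    ∃ G : Set (Atom R (α ⊕ Fin n)), G.Finite ∧
      ∀ (x : α → M) (xs : Fin n → M) (x' : α → M') (xs' : Fin n → M'),
        Agree G (Sum.elim x xs) (Sum.elim x' xs') →
        (∀ y, ∃ y', Agree F (Sum.elim x (Fin.snoc xs y : Fin (n + 1) → M))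
          (Sum.elim x' (Fin.snoc xs' y' : Fin (n + 1) → M'))) ∧
        ∀ y', ∃ y, Agree F (Sum.elim x (Fin.snoc xs y : Fin (n + 1) → M))
          (Sum.elim x' (Fin.snoc xs' y' : Fin (n + 1) → M')) := by
  classical
  -- `C` is a common multiple of the coefficients of the last variable, `d c` the cofactor of `c`.
  -- `K` lists the linear forms that `C • y` is compared with, and `P` the moduli.
  let Q : Finset R := hF.toFinset.image fun A => lastCoeff A.coeff
  let C : R := ∏ c ∈ Q with c ≠ 0, c
  have hC : C ≠ 0 := Finset.prod_ne_zero_iff.2 fun c hc => (Finset.mem_filter.1 hc).2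
  have hdvd : ∀ c, ∃ d, c ∈ Q → c ≠ 0 → d * c = C := by
    intro c
    by_cases hc : c ∈ Q ∧ c ≠ 0
    · obtain ⟨d, hd⟩ := Finset.dvd_prod_of_mem (fun c => c)
        (show c ∈ Q.filter (· ≠ 0) from Finset.mem_filter.2 hc)
      exact ⟨d, fun _ _ => by rw [mul_comm]; exact hd.symm⟩
    · exact ⟨0, fun h1 h2 => absurd ⟨h1, h2⟩ hc⟩
  choose d hd using hdvd
  replace hd : ∀ A ∈ F, lastCoeff A.coeff ≠ 0 → d (lastCoeff A.coeff) * lastCoeff A.coeff = C :=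
    fun A hA => hd _ (Finset.mem_image_of_mem _ (hF.mem_toFinset.2 hA))
  let K : Set (α ⊕ Fin n → R) :=
    insert 0 ((fun A => -(d (lastCoeff A.coeff) • initForm A.coeff)) '' F)
  have hK : K.Finite := (hF.image _).insert _
  have hK0 : 0 ∈ K := Set.mem_insert _ _
  have hKF : ∀ A ∈ F, -(d (lastCoeff A.coeff) • initForm A.coeff) ∈ K := fun A hA =>
    Set.mem_insert_of_mem _ ⟨A, hA, rfl⟩
  let P : Set R := insert C ((fun A => d (lastCoeff A.coeff) * A.modulus) '' F)
  have hP : P.Finite := (hF.image _).insert _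
  have hPC : C ∈ P := Set.mem_insert _ _
  have hPF : ∀ A ∈ F, d (lastCoeff A.coeff) * A.modulus ∈ P := fun A hA =>
    Set.mem_insert_of_mem _ ⟨A, hA, rfl⟩
  let G : Set (Atom R (α ⊕ Fin n)) := Atom.mapCoeff initForm '' F ∪
    (Set.image2 (fun a b => Atom.pos (b - a)) K K ∪
      Set.image2 Atom.dvd (Set.image2 (fun r s => IsBezout.gcd r s) P P)
        (Set.image2 (fun a b => a - b) K K))
  have hGF : ∀ A ∈ F, A.mapCoeff initForm ∈ G := fun A hA => Or.inl ⟨A, hA, rfl⟩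
  have hGpos : ∀ a ∈ K, ∀ b ∈ K, Atom.pos (b - a) ∈ G := fun a ha b hb =>
    Or.inr (Or.inl ⟨a, ha, b, hb, rfl⟩)
  have hGdvd : ∀ a ∈ K, ∀ b ∈ K, ∀ r ∈ P, ∀ s ∈ P, Atom.dvd (IsBezout.gcd r s) (a - b) ∈ G :=
    fun a ha b hb r hr s hs => Or.inr (Or.inr ⟨_, ⟨r, hr, s, hs, rfl⟩, _, ⟨a, ha, b, hb, rfl⟩, rfl⟩)
  refine ⟨G, (hF.image _).union ((hK.image2 _ hK).union ((hP.image2 _ hP).image2 _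
    (hK.image2 _ hK))), fun x xs x' xs' hag => ⟨fun y => ?_, fun y' => ?_⟩⟩
  · exact exists_agree_snoc hM hM' hC hd hK hK0 hKF hP hPC hPF hGF hGpos hGdvd hag y
  · obtain ⟨y, hy⟩ :=
      exists_agree_snoc hM' hM hC hd hK hK0 hKF hP hPC hPF hGF hGpos hGdvd hag.symm y'
    exact ⟨y, hy.symm⟩

end Elimination

/-! ### Formulas are determined by finitely many atomic conditions -/

section Formulas

/-- Every term is a linear form. Its coefficients do not depend on the module. -/
theorem exists_realize_eq {R : Type u} [CommRing R] {β : Type} [Fintype β]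
    {M : Type v} [AddCommGroup M] [LT M] [Module R M]
    {M' : Type w} [AddCommGroup M'] [LT M'] [Module R M'] (t : (lang R).Term β) :
    ∃ c : β → R, (∀ x : β → M, t.realize x = Fintype.linearCombination R x c) ∧
      ∀ x : β → M', t.realize x = Fintype.linearCombination R x c := by
  classical
  induction t with
  | var j =>
    exact ⟨Pi.single j 1, fun x => by simp [Fintype.linearCombination_apply_single],
      fun x => by simp [Fintype.linearCombination_apply_single]⟩
  | func f ts ih =>
    choose c hc hc' using ih
    cases f with
    | zero => exact ⟨0, fun x => by rw [map_zero]; rfl, fun x => by rw [map_zero]; rfl⟩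
    | add =>
      refine ⟨c 0 + c 1, fun x => ?_, fun x => ?_⟩
      · rw [map_add, ← hc, ← hc]; rfl
      · rw [map_add, ← hc', ← hc']; rfl
    | smul r =>
      refine ⟨r • c 0, fun x => ?_, fun x => ?_⟩
      · rw [map_smul, ← hc]; rfl
      · rw [map_smul, ← hc']; rfl

variable {R : Type u} [CommRing R] [LinearOrder R] [IsStrictOrderedRing R]
  [IsPrincipalIdealRing R] [DenselyOrdered R]
  {M : Type v} [AddCommGroup M] [LinearOrder M] [IsOrderedAddMonoid M] [Module R M] [Nontrivial M]
  {M' : Type w} [AddCommGroup M'] [LinearOrder M'] [IsOrderedAddMonoid M'] [Module R M']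
  [Nontrivial M']

/-- Each formula has a finite set of atomic conditions such that tuples of two dense modules which
satisfy the same of them agree about the formula. -/
theorem exists_finite_forall_agree (hM : IsDenseModule R M) (hM' : IsDenseModule R M') {α : Type}
    [Fintype α] {n : ℕ} (φ : (lang R).BoundedFormula α n) :
    ∃ G : Set (Atom R (α ⊕ Fin n)), G.Finite ∧
      ∀ (x : α → M) (xs : Fin n → M) (x' : α → M') (xs' : Fin n → M'),
        Agree G (Sum.elim x xs) (Sum.elim x' xs') → (φ.Realize x xs ↔ φ.Realize x' xs') := by
  induction φ with
  | falsum => exact ⟨∅, Set.finite_empty, fun _ _ _ _ _ => Iff.rfl⟩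
  | equal t₁ t₂ =>
    obtain ⟨c₁, h₁, h₁'⟩ := exists_realize_eq (M := M) (M' := M') t₁
    obtain ⟨c₂, h₂, h₂'⟩ := exists_realize_eq (M := M) (M' := M') t₂
    refine ⟨{Atom.dvd 0 (c₁ - c₂)}, Set.finite_singleton _, fun x xs x' xs' h => ?_⟩
    have := h _ rfl
    simp only [Atom.Holds, mulSub_zero, Submodule.mem_bot, map_sub, sub_eq_zero] at this
    change t₁.realize _ = t₂.realize _ ↔ t₁.realize _ = t₂.realize _
    rwa [h₁, h₁', h₂, h₂']
  | rel S ts =>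
    cases S with
    | lt =>
      obtain ⟨c₁, h₁, h₁'⟩ := exists_realize_eq (M := M) (M' := M') (ts 0)
      obtain ⟨c₂, h₂, h₂'⟩ := exists_realize_eq (M := M) (M' := M') (ts 1)
      refine ⟨{Atom.pos (c₂ - c₁)}, Set.finite_singleton _, fun x xs x' xs' h => ?_⟩
      have := h _ rfl
      simp only [Atom.Holds, map_sub, sub_pos] at this
      change (ts 0).realize _ < (ts 1).realize _ ↔ (ts 0).realize _ < (ts 1).realize _
      rwa [h₁, h₁', h₂, h₂']
  | imp φ ψ ih₁ ih₂ =>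
    obtain ⟨G₁, hG₁, h₁⟩ := ih₁
    obtain ⟨G₂, hG₂, h₂⟩ := ih₂
    refine ⟨G₁ ∪ G₂, hG₁.union hG₂, fun x xs x' xs' h => ?_⟩
    rw [BoundedFormula.realize_imp, BoundedFormula.realize_imp,
      h₁ _ _ _ _ (h.mono Set.subset_union_left), h₂ _ _ _ _ (h.mono Set.subset_union_right)]
  | all φ ih =>
    obtain ⟨F, hF, h⟩ := ih
    obtain ⟨G, hG, hGF⟩ := exists_finite_agree_snoc hM hM' hF
    refine ⟨G, hG, fun x xs x' xs' hag => ?_⟩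
    obtain ⟨h₁, h₂⟩ := hGF _ _ _ _ hag
    rw [BoundedFormula.realize_all, BoundedFormula.realize_all]
    constructor
    · intro H y'
      obtain ⟨y, hy⟩ := h₂ y'
      exact (h _ _ _ _ hy).1 (H y)
    · intro H y
      obtain ⟨y', hy⟩ := h₁ y
      exact (h _ _ _ _ hy).2 (H y')

/-- Any two dense modules are elementarily equivalent. -/
theorem realize_sentence_iff (hM : IsDenseModule R M) (hM' : IsDenseModule R M')
    (φ : (lang R).Sentence) : M ⊨ φ ↔ M' ⊨ φ := by
  obtain ⟨G, -, h⟩ := exists_finite_forall_agree hM hM' φ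
  refine h _ _ _ _ fun A _ => ?_
  -- Linear forms in no variables vanish.
  cases A <;> simp [Atom.Holds, Fintype.linearCombination_apply]

end Formulas

/-! ### Transfer between models of the theory -/

section Symbols

variable {R : Type u}

/-- The function symbol `+`. -/
abbrev addSym : (lang R).Functions 2 := Func.add

/-- The function symbol `λ_r`. -/
abbrev smulSym (r : R) : (lang R).Functions 1 := Func.smul r

/-- The relation symbol `<`. -/
abbrev ltSym : (lang R).Relations 2 := Rel.lt

end Symbols

section Transfer

theorem exists_realize_iff {L : FirstOrder.Language.{u, v}} {M : Type w} [L.Structure M]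
    {N : Type*} [L.Structure N] [N ⊨ L.completeTheory M] {β : Type} [Finite β] (χ : L.Formula β) :
    (∃ x : β → N, χ.Realize x) ↔ ∃ x : β → M, χ.Realize x := by
  have h := realize_iff_of_model_completeTheory (L := L) M N
    ((χ.relabel (Sum.inr : β → Empty ⊕ β)).iExs β)
  simpa only [Sentence.Realize, Formula.realize_iExs, Formula.realize_relabel,
    Sum.elim_comp_inr] using h

theorem forall_realize_iff {L : FirstOrder.Language.{u, v}} {M : Type w} [L.Structure M]
    {N : Type*} [L.Structure N] [N ⊨ L.completeTheory M] {β : Type} [Finite β] (χ : L.Formula β) :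
    (∀ x : β → N, χ.Realize x) ↔ ∀ x : β → M, χ.Realize x := by
  simpa using not_congr (exists_realize_iff (M := M) (N := N) χ.not)

variable {R : Type u} [CommRing R]

theorem isDenseModule_self [LinearOrder R] [IsStrictOrderedRing R]
    (hdense : ∀ p : R, Prime p → DenseIn (Ideal.span {p} : Set R))
    (hinf : ∀ p : R, Prime p → Infinite (R ⧸ Ideal.span {p})) : IsDenseModule R R where
  smul_pos _ _ := mul_pos
  dense p hp := coe_span_singleton p ▸ hdense p hp
  infinite p hp := by
    have h : mulSub p R = Ideal.span {p} := SetLike.coe_injective (coe_span_singleton p).symm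
    rw [h]
    exact hinf p hp

variable {M : Type v} [AddCommGroup M] [LinearOrder M] [Module R M]

/-- The formula `x₀ < x₁ ∧ ¬ ∃ y, x₀ < r • y ∧ r • y < x₁`. -/
def gapFormula (r : R) : (lang R).Formula (Fin 2) :=
  let lt {n : ℕ} : (lang R).Term (Fin 2 ⊕ Fin n) → (lang R).Term (Fin 2 ⊕ Fin n) →
      (lang R).BoundedFormula (Fin 2) n :=
    ltSym.boundedFormula₂
  let x {n : ℕ} (i : Fin 2) : (lang R).Term (Fin 2 ⊕ Fin n) := Term.var (Sum.inl i)
  let ry : (lang R).Term (Fin 2 ⊕ Fin 1) := (smulSym r).apply₁ (&0)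
  lt (x 0) (x 1) ⊓ (∃' (lt (x 0) ry ⊓ lt ry (x 1))).not

theorem realize_gapFormula (r : R) (x : Fin 2 → M) :
    (gapFormula r).Realize x ↔ x 0 < x 1 ∧ ¬ ∃ y : M, x 0 < r • y ∧ r • y < x 1 := by
  simp only [gapFormula, Formula.Realize, BoundedFormula.realize_inf, BoundedFormula.realize_not,
    BoundedFormula.realize_ex]
  exact Iff.rfl

/-- The formula `∀ z, ∃ y, z = x_i + r • y for some i < k`. -/
noncomputable def coverFormula (r : R) (k : ℕ) : (lang R).Formula (Fin k) :=
  ∀' ∃' BoundedFormula.iSup fun i : Fin k =>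
    (&0 : (lang R).Term (Fin k ⊕ Fin 2)) ='
      addSym.apply₂ (Term.var (Sum.inl i)) ((smulSym r).apply₁ (&1))

theorem realize_coverFormula (r : R) (k : ℕ) (x : Fin k → M) :
    (coverFormula r k).Realize x ↔ ∀ z : M, ∃ y : M, ∃ i, z = x i + r • y := by
  simp only [coverFormula, Formula.Realize, BoundedFormula.realize_all, BoundedFormula.realize_ex,
    BoundedFormula.realize_iSup, BoundedFormula.realize_bdEqual]
  exact Iff.rfl

theorem finite_quotient_iff_exists_coverFormula (r : R) :
    Finite (M ⧸ mulSub r M) ↔ ∃ k, ∃ x : Fin k → M, (coverFormula r k).Realize x := by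
  simp only [realize_coverFormula]
  constructor
  · intro h
    obtain ⟨k, ⟨e⟩⟩ := Finite.exists_equiv_fin (M ⧸ mulSub r M)
    refine ⟨k, fun i => (e.symm i).out, fun z => ?_⟩
    have hz : (Submodule.Quotient.mk (e.symm (e (Submodule.Quotient.mk z))).out :
        M ⧸ mulSub r M) = Submodule.Quotient.mk z := by
      rw [Equiv.symm_apply_apply]
      exact Quotient.out_eq' _
    obtain ⟨y, hy⟩ := mem_mulSub.1 ((Submodule.Quotient.eq _).1 hz.symm)
    exact ⟨y, _, by rw [hy, add_sub_cancel]⟩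
  · rintro ⟨k, x, hx⟩
    refine Finite.of_surjective (fun i : Fin k => (Submodule.Quotient.mk (x i) : M ⧸ mulSub r M)) ?_
    intro q
    obtain ⟨z, rfl⟩ := Submodule.Quotient.mk_surjective _ q
    obtain ⟨y, i, rfl⟩ := hx z
    refine ⟨i, (Submodule.Quotient.eq _).2 ?_⟩
    rw [sub_add_cancel_left]
    exact neg_mem (mem_mulSub.2 ⟨y, rfl⟩)

variable [LinearOrder R]

theorem IsDenseModule.of_model (hR : IsDenseModule R R)
    (hpos : ∀ (r : R) (m : M), 0 < r → 0 < m → 0 < r • m) (hM : M ⊨ theory R) :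
    IsDenseModule R M := by
  have : M ⊨ (lang R).completeTheory R := hM
  refine ⟨hpos, fun p hp a b hab => ?_, fun p hp => not_finite_iff_infinite.1 fun hfin => ?_⟩
  · by_contra! hcon
    have hgap : ∃ x : Fin 2 → M, (gapFormula p).Realize x :=
      ⟨![a, b], (realize_gapFormula p _).2 ⟨hab, fun ⟨y, h1, h2⟩ =>
        absurd h2 (not_lt.2 (hcon _ (mem_mulSub.2 ⟨y, rfl⟩) h1))⟩⟩
    obtain ⟨x, hx⟩ := (exists_realize_iff (M := R) _).1 hgap
    obtain ⟨hlt, hno⟩ := (realize_gapFormula p x).1 hx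
    obtain ⟨c, hc, h1, h2⟩ := hR.dense p hp _ _ hlt
    obtain ⟨y, rfl⟩ := mem_mulSub.1 hc
    exact hno ⟨y, h1, h2⟩
  · obtain ⟨k, hk⟩ := (finite_quotient_iff_exists_coverFormula p).1 hfin
    have := (finite_quotient_iff_exists_coverFormula (M := R) p).2
      ⟨k, (exists_realize_iff (M := R) _).1 hk⟩
    exact (hR.infinite p hp).not_finite this

theorem model_theory_iff [IsStrictOrderedRing R] [IsPrincipalIdealRing R] [DenselyOrdered R]
    [IsOrderedAddMonoid M] [Nontrivial M] (hR : IsDenseModule R R)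
    (hpos : ∀ (r : R) (m : M), 0 < r → 0 < m → 0 < r • m) :
    M ⊨ theory R ↔ ∀ p : R, Prime p →
      DenseIn (mulSub p M : Set M) ∧ Infinite (M ⧸ mulSub p M) := by
  constructor
  · intro hM p hp
    have hM := IsDenseModule.of_model hR hpos hM
    exact ⟨hM.dense p hp, hM.infinite p hp⟩
  · intro h
    have hM : IsDenseModule R M := ⟨hpos, fun p hp => (h p hp).1, fun p hp => (h p hp).2⟩
    exact ⟨fun φ hφ => (realize_sentence_iff hR hM φ).1 hφ⟩

end Transfer

/-! ### Quantifier elimination -/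

/-- The standard interpretation of the divisibility predicates in a module. -/
instance divInterp (R : Type u) (M : Type v) [SMul R M] : (divLang R).Structure M where
  funMap f _ := f.elim
  RelMap s x :=
    match s with
    | DivRel.dvd r => ∃ y : M, r • y = x 0

section QuantifierFree

variable {R : Type u} [CommRing R] [LinearOrder R]

theorem exists_term_realize_eq {β : Type} [Fintype β] (c : β → R) :
    ∃ t : (langP R).Term β, ∀ x : β → R, t.realize x = Fintype.linearCombination R x c := by
  classical
  suffices h : ∀ s : Finset β, ∃ t : (langP R).Term β, ∀ x : β → R,
      t.realize x = ∑ j ∈ s, c j • x j from h Finset.univ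
  intro s
  induction s using Finset.induction_on with
  | empty =>
    exact ⟨Term.func (L := langP R) (Sum.inl Func.zero) Fin.elim0, fun x => rfl⟩
  | insert j s hj ih =>
    obtain ⟨t, ht⟩ := ih
    refine ⟨Functions.apply₂ (L := langP R) (Sum.inl addSym)
      (Functions.apply₁ (lamP (c j)) (Term.var j)) t, fun x => ?_⟩
    rw [Finset.sum_insert hj, ← ht]
    rfl

theorem exists_isQF_realize_iff_holds {α : Type} [Fintype α] {n : ℕ} (A : Atom R (α ⊕ Fin n)) :
    ∃ ψ : (langP R).BoundedFormula α n, ψ.IsQF ∧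
      ∀ (x : α → R) (xs : Fin n → R), ψ.Realize x xs ↔ A.Holds (Sum.elim x xs) := by
  cases A with
  | pos c =>
    obtain ⟨t₀, h₀⟩ := exists_term_realize_eq (0 : α ⊕ Fin n → R)
    obtain ⟨t, ht⟩ := exists_term_realize_eq c
    refine ⟨Relations.boundedFormula₂ (L := langP R) (Sum.inl ltSym) t₀ t,
      (BoundedFormula.IsAtomic.rel _ _).isQF, fun x xs => ?_⟩
    change t₀.realize _ < t.realize _ ↔ _
    rw [h₀, ht, map_zero]
    exact Iff.rfl
  | dvd r c =>
    obtain ⟨t, ht⟩ := exists_term_realize_eq c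
    refine ⟨(divP r).boundedFormula₁ t, (BoundedFormula.IsAtomic.rel _ _).isQF, fun x xs => ?_⟩
    rw [BoundedFormula.realize_rel₁, ht]
    exact mem_mulSub.symm

/-- A condition on tuples that depends only on the truth of finitely many atomic conditions is
defined by a quantifier-free formula. -/
theorem exists_isQF_realize_iff {α : Type} [Fintype α] {n : ℕ} {G : Set (Atom R (α ⊕ Fin n))}
    (hG : G.Finite) (D : (α ⊕ Fin n → R) → Prop) (hD : ∀ x x', Agree G x x' → (D x ↔ D x')) :
    ∃ ψ : (langP R).BoundedFormula α n, ψ.IsQF ∧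
      ∀ (x : α → R) (xs : Fin n → R), ψ.Realize x xs ↔ D (Sum.elim x xs) := by
  induction G, hG using Set.Finite.induction_on generalizing D with
  | empty =>
    have h : ∀ x x', D x ↔ D x' := fun x x' => hD x x' fun A hA => hA.elim
    by_cases h0 : D 0
    · refine ⟨⊤, BoundedFormula.IsQF.top, fun x xs => ?_⟩
      rw [BoundedFormula.realize_top]
      exact iff_of_true trivial ((h _ _).2 h0)
    · exact ⟨⊥, BoundedFormula.isQF_bot, fun x xs => iff_of_false id fun hx => h0 ((h _ _).2 hx)⟩
  | @insert A G _ _ ih =>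
    obtain ⟨ψ, hψ, hψA⟩ := exists_isQF_realize_iff_holds A
    -- `D` is split according to the truth value of `A`.
    have hsplit : ∀ P : Prop, ∃ χ : (langP R).BoundedFormula α n, χ.IsQF ∧
        ∀ (x : α → R) (xs : Fin n → R), (A.Holds (Sum.elim x xs) ↔ P) →
          (χ.Realize x xs ↔ D (Sum.elim x xs)) := by
      intro P
      obtain ⟨χ, hχ, h⟩ := ih (fun x => ∃ x', Agree G x x' ∧ (A.Holds x' ↔ P) ∧ D x') <| by
        intro x x' hxx'
        exact exists_congr fun y => and_congr_left fun _ =>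
          ⟨fun h B hB => (hxx' B hB).symm.trans (h B hB), fun h B hB => (hxx' B hB).trans (h B hB)⟩
      refine ⟨χ, hχ, fun x xs hP => (h x xs).trans ⟨?_, fun hx => ⟨_, fun _ _ => Iff.rfl, hP, hx⟩⟩⟩
      rintro ⟨x', hag, hP', hx'⟩
      refine (hD _ x' fun B hB => ?_).2 hx'
      rcases Set.mem_insert_iff.1 hB with rfl | hB
      · exact hP.trans hP'.symm
      · exact hag B hB
    obtain ⟨χ₁, hχ₁, h₁⟩ := hsplit True
    obtain ⟨χ₀, hχ₀, h₀⟩ := hsplit False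
    refine ⟨(ψ ⊓ χ₁) ⊔ (ψ.not ⊓ χ₀), (hψ.inf hχ₁).sup (hψ.not.inf hχ₀), fun x xs => ?_⟩
    rw [BoundedFormula.realize_sup, BoundedFormula.realize_inf, BoundedFormula.realize_inf,
      BoundedFormula.realize_not, hψA]
    by_cases hA : A.Holds (Sum.elim x xs)
    · simp [hA, h₁ x xs (iff_true_intro hA)]
    · simp [hA, h₀ x xs (iff_false_intro hA)]

end QuantifierFree

section Translation

variable {R : Type u}

theorem exists_term_forall_realize_eq {β : Type} (t : (langP R).Term β) :
    ∃ t' : (lang R).Term β, ∀ (N : Type w) [(langP R).Structure N] [(lang R).Structure N]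
      [LHom.IsExpansionOn (LHom.sumInl : lang R →ᴸ langP R) N] (x : β → N),
      t'.realize x = t.realize x := by
  induction t with
  | var j => exact ⟨Term.var j, fun N _ _ _ x => rfl⟩
  | func f ts ih =>
    choose ts' h using ih
    cases f with
    | inl f =>
      refine ⟨Term.func f ts', fun N _ _ _ x => ?_⟩
      have hts : (fun i => (ts' i).realize x) = fun i => (ts i).realize x :=
        funext fun i => h i N x
      change Structure.funMap f (fun i => (ts' i).realize x) = _
      rw [hts]
      exact (LHom.map_onFunction (LHom.sumInl : lang R →ᴸ langP R) f _).symm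
    | inr e => exact e.elim

/-- The predicates `P_r` can be eliminated in favour of quantifiers, uniformly in all structures
satisfying their definitions. -/
theorem exists_forall_realize_iff {α : Type} {n : ℕ} (φ : (langP R).BoundedFormula α n) :
    ∃ φ' : (lang R).BoundedFormula α n, ∀ (N : Type w) [(langP R).Structure N]
      [(lang R).Structure N] [LHom.IsExpansionOn (LHom.sumInl : lang R →ᴸ langP R) N],
      (∀ r : R, N ⊨ divAxiom r) → ∀ (x : α → N) (xs : Fin n → N),
        φ'.Realize x xs ↔ φ.Realize x xs := by
  induction φ with
  | falsum => exact ⟨⊥, fun N _ _ _ _ x xs => Iff.rfl⟩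
  | equal t₁ t₂ =>
    obtain ⟨t₁', h₁⟩ := exists_term_forall_realize_eq.{u, w} t₁
    obtain ⟨t₂', h₂⟩ := exists_term_forall_realize_eq.{u, w} t₂
    refine ⟨t₁' =' t₂', fun N _ _ _ _ x xs => ?_⟩
    rw [BoundedFormula.realize_bdEqual, h₁, h₂]
    exact Iff.rfl
  | @rel n l S ts =>
    choose ts' h using fun i => exists_term_forall_realize_eq.{u, w} (ts i)
    cases S with
    | inl S =>
      refine ⟨BoundedFormula.rel S ts', fun N _ _ _ _ x xs => ?_⟩
      have hts : (fun i => (ts' i).realize (Sum.elim x xs)) =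
          fun i => (ts i).realize (Sum.elim x xs) := funext fun i => h i N _
      change Structure.RelMap S (fun i => (ts' i).realize (Sum.elim x xs)) ↔ _
      rw [hts]
      exact iff_of_eq (LHom.map_onRelation (LHom.sumInl : lang R →ᴸ langP R) S _).symm
    | inr S =>
      cases S with
      | dvd r =>
        refine ⟨∃' ((smulSym r).apply₁ (Term.var (Sum.inr (Fin.last n))) ='
          (ts' 0).relabel (Sum.map id Fin.castSucc)), fun N _ _ _ hN x xs => ?_⟩
        have hax : ∀ a : N, Structure.RelMap (divP r) ![a] ↔
            ∃ b : N, Structure.funMap (lamP r) ![b] = a := by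
          have := hN r
          simp only [divAxiom, Sentence.Realize, Formula.Realize, BoundedFormula.realize_all,
            BoundedFormula.realize_iff, BoundedFormula.realize_rel₁, BoundedFormula.realize_ex,
            BoundedFormula.realize_bdEqual, Term.realize_functions_apply₁] at this
          exact this
        have hts : (fun i => (ts i).realize (Sum.elim x xs)) =
            ![(ts 0).realize (Sum.elim x xs)] := by
          funext i
          rw [Subsingleton.elim i 0]
          rfl
        change _ ↔ Structure.RelMap (divP r) fun i => (ts i).realize (Sum.elim x xs)
        rw [hts, hax]
        rw [BoundedFormula.realize_ex]
        refine exists_congr fun b => ?_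
        rw [BoundedFormula.realize_bdEqual, Term.realize_functions_apply₁, Term.realize_relabel,
          ← h 0 N, Sum.elim_comp_map, Fin.snoc_comp_castSucc, Function.comp_id]
        have hfun := LHom.map_onFunction (LHom.sumInl : lang R →ᴸ langP R) (M := N)
          (smulSym r) ![b]
        simp only [Term.realize_var, Sum.elim_inr, Fin.snoc_last]
        rw [← hfun]
        exact Iff.rfl
  | imp φ ψ ih₁ ih₂ =>
    obtain ⟨φ', h₁⟩ := ih₁
    obtain ⟨ψ', h₂⟩ := ih₂
    exact ⟨φ'.imp ψ', fun N _ _ _ hN x xs => imp_congr (h₁ N hN x xs) (h₂ N hN x xs)⟩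
  | all φ ih =>
    obtain ⟨φ', h⟩ := ih
    exact ⟨φ'.all, fun N _ _ _ hN x xs => forall_congr' fun a => h N hN x _⟩

theorem realize_divAxiom [CommRing R] [LT R] {M : Type v} [AddCommGroup M] [LT M] [Module R M]
    (r : R) : M ⊨ divAxiom r := by
  simp only [divAxiom, Sentence.Realize, Formula.Realize, BoundedFormula.realize_all,
    BoundedFormula.realize_iff, BoundedFormula.realize_rel₁, BoundedFormula.realize_ex,
    BoundedFormula.realize_bdEqual, Term.realize_functions_apply₁]
  exact fun a => Iff.rfl

end Translation

theorem elimQuantifiers_theoryP {R : Type u} [CommRing R] [LinearOrder R] [IsStrictOrderedRing R]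
    [IsPrincipalIdealRing R] [DenselyOrdered R] (hR : IsDenseModule R R) :
    ElimQuantifiers (theoryP R) := by
  intro n φ
  obtain ⟨φ', hφ'⟩ := exists_forall_realize_iff.{u, u} φ
  obtain ⟨G, hG, hGφ⟩ := exists_finite_forall_agree hR hR φ'
  obtain ⟨ψ, hψ, hψφ⟩ := exists_isQF_realize_iff hG
    (fun x => φ'.Realize (x ∘ Sum.inl) (x ∘ Sum.inr)) fun x x' h => by
      refine hGφ _ _ _ _ ?_
      rwa [Sum.elim_comp_inl_inr, Sum.elim_comp_inl_inr]
  obtain ⟨ψ', hψ'⟩ := exists_forall_realize_iff.{u, u} ψ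
  refine ⟨ψ, hψ, Theory.models_formula_iff.2 fun N x => ?_⟩
  let _ : (lang R).Structure N := (LHom.sumInl : lang R →ᴸ langP R).reduct N
  have hN : N ⊨ (lang R).completeTheory R := by
    refine ((LHom.sumInl : lang R →ᴸ langP R).onTheory_model (theory R)).1 ?_
    exact Theory.Model.mono N.is_model Set.subset_union_left
  have hdiv : ∀ r : R, N ⊨ divAxiom r := fun r =>
    (theoryP R).realize_sentence_of_mem (Or.inr ⟨r, rfl⟩)
  have key : ∀ x : Fin n → N, (Formula.iff φ' ψ').Realize x := by
    refine (forall_realize_iff (M := R) _).2 fun x => ?_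
    refine Formula.realize_iff.2 ?_
    rw [Formula.Realize, Formula.Realize, hψ' R realize_divAxiom, hψφ]
    rfl
  have := Formula.realize_iff.1 (key x)
  rw [Formula.Realize, Formula.Realize, hφ' N hdiv, hψ' N hdiv] at this
  exact Formula.realize_iff.2 this

/-! ### The independence property -/

section NIP

/-- On `k` first arguments, the condition `0 < p i + q s` cuts out at most `k + 1` sets as `s`
varies: they form a chain, and are determined by their cardinality. -/
theorem exists_code_pos {M : Type v} [AddCommGroup M] [LinearOrder M] [IsOrderedAddMonoid M]
    {σ : Type*} {k : ℕ} (p : Fin k → M) (q : σ → M) :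
    ∃ code : σ → Fin (k + 1), ∀ s s', code s = code s' → ∀ i, 0 < p i + q s ↔ 0 < p i + q s' := by
  classical
  let T : σ → Finset (Fin k) := fun s => {i | 0 < p i + q s}
  have hmono : ∀ s s', q s ≤ q s' → T s ⊆ T s' := fun s s' h i hi => by
    simp only [T, Finset.mem_filter, Finset.mem_univ, true_and] at hi ⊢
    exact hi.trans_le (by gcongr)
  have hcard : ∀ s, (T s).card < k + 1 := fun s =>
    Nat.lt_succ_of_le ((Finset.card_le_univ _).trans_eq (Fintype.card_fin k))
  refine ⟨fun s => ⟨(T s).card, hcard s⟩, fun s s' h i => ?_⟩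
  replace h : (T s).card = (T s').card := congrArg Fin.val h
  have hT : T s = T s' := by
    rcases le_total (q s) (q s') with hq | hq
    · exact Finset.eq_of_subset_of_card_le (hmono _ _ hq) h.ge
    · exact (Finset.eq_of_subset_of_card_le (hmono _ _ hq) h.le).symm
  have := Finset.ext_iff.1 hT i
  simpa [T] using this

/-- On `k` first arguments, membership of `p i + q s` in a subgroup cuts out at most `k + 1` sets
as `s` varies: those which are non-empty are pairwise disjoint, so that one element determines
them. -/
theorem exists_code_mem {M : Type v} [AddCommGroup M] (H : AddSubgroup M) {σ : Type*} {k : ℕ}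
    (p : Fin k → M) (q : σ → M) :
    ∃ code : σ → Fin (k + 1), ∀ s s', code s = code s' → ∀ i, p i + q s ∈ H ↔ p i + q s' ∈ H := by
  have h : ∀ s, ∃ o : Option (Fin k), (∀ j ∈ o, p j + q s ∈ H) ∧
      (o = none → ∀ i, p i + q s ∉ H) := by
    intro s
    by_cases hs : ∃ i, p i + q s ∈ H
    · obtain ⟨i, hi⟩ := hs
      exact ⟨some i, by simpa using hi, by simp⟩
    · exact ⟨none, by simp, fun _ => not_exists.1 hs⟩
  choose o ho ho' using h
  refine ⟨fun s => (finSuccEquiv k).symm (o s), fun s s' hss' i => ?_⟩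
  replace hss' : o s = o s' := (finSuccEquiv k).symm.injective hss'
  cases hs : o s with
  | none => exact iff_of_false (ho' s hs i) (ho' s' (hss' ▸ hs) i)
  | some j =>
    have hq : q s - q s' ∈ H := by
      rw [← add_sub_add_left_eq_sub _ _ (p j)]
      exact sub_mem (ho s j hs) (ho s' j (hss' ▸ hs))
    rw [← add_sub_cancel (q s') (q s), ← add_assoc]
    exact add_mem_cancel_right hq

theorem exists_code_holds {R : Type u} [CommRing R] {M : Type v} [AddCommGroup M] [LinearOrder M]
    [IsOrderedAddMonoid M] [Module R M] {V W : Type} [Fintype V] [Fintype W]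
    (A : Atom R ((V ⊕ W) ⊕ Fin 0)) {σ : Type*} {k : ℕ} (a : Fin k → V → M) (b : σ → W → M)
    (e : Fin 0 → M) :
    ∃ code : σ → Fin (k + 1), ∀ s s', code s = code s' → ∀ i,
      A.Holds (Sum.elim (Sum.elim (a i) (b s)) e) ↔
        A.Holds (Sum.elim (Sum.elim (a i) (b s')) e) := by
  cases A with
  | pos c =>
    have := exists_code_pos (fun i => ∑ j, c (Sum.inl (Sum.inl j)) • a i j)
      fun s => ∑ j, c (Sum.inl (Sum.inr j)) • b s j
    simpa [Atom.Holds, Fintype.linearCombination_apply] using this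
  | dvd r c =>
    have := exists_code_mem (mulSub r M).toAddSubgroup
      (fun i => ∑ j, c (Sum.inl (Sum.inl j)) • a i j)
      fun s => ∑ j, c (Sum.inl (Sum.inr j)) • b s j
    simpa [Atom.Holds, Fintype.linearCombination_apply] using this

theorem exists_succ_pow_lt_two_pow (d : ℕ) : ∃ k : ℕ, (k + 1) ^ d < 2 ^ k := by
  have h := (tendsto_pow_const_div_const_pow_of_one_lt d (one_lt_two (α := ℝ))).comp
    (Filter.tendsto_add_atTop_nat 1)
  obtain ⟨k, hk⟩ := (h.eventually_lt_const (show (0 : ℝ) < 1 / 2 by norm_num)).exists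
  refine ⟨k, ?_⟩
  simp only [Function.comp_apply] at hk
  rw [div_lt_iff₀ (by positivity), pow_succ (2 : ℝ)] at hk
  have : ((k + 1 : ℕ) : ℝ) ^ d < 2 ^ k := by linarith
  exact_mod_cast this

/-- The formula saying of tuples `a i` (`i < k`) and `b s` (`s ⊆ {0, …, k - 1}`) that `φ(a i, b s)`
holds if and only if `i ∈ s`. -/
noncomputable def patternFormula {L : FirstOrder.Language.{u, v}} {m n : ℕ}
    (φ : L.Formula (Fin m ⊕ Fin n)) (k : ℕ) :
    L.Formula ((Fin k × Fin m) ⊕ (Set (Fin k) × Fin n)) :=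
  open Classical in
  Formula.iInf fun c : Fin k × Set (Fin k) =>
    if c.1 ∈ c.2 then φ.relabel (Sum.map (Prod.mk c.1) (Prod.mk c.2))
    else (φ.relabel (Sum.map (Prod.mk c.1) (Prod.mk c.2))).not

theorem realize_patternFormula {L : FirstOrder.Language.{u, v}} {m n : ℕ}
    (φ : L.Formula (Fin m ⊕ Fin n)) (k : ℕ) {M : Type w} [L.Structure M]
    (x : (Fin k × Fin m) ⊕ (Set (Fin k) × Fin n) → M) :
    (patternFormula φ k).Realize x ↔ ∀ (i : Fin k) (s : Set (Fin k)),
      φ.Realize (Sum.elim (fun j => x (Sum.inl (i, j))) fun j => x (Sum.inr (s, j))) ↔ i ∈ s := by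
  rw [patternFormula, Formula.realize_iInf, Prod.forall]
  refine forall_congr' fun i => forall_congr' fun s => ?_
  have hx : x ∘ Sum.map (Prod.mk i) (Prod.mk s) =
      Sum.elim (fun j => x (Sum.inl (i, j))) fun j => x (Sum.inr (s, j)) := by
    ext (j | j) <;> rfl
  split_ifs with hi
  · rw [Formula.realize_relabel, hx]
    exact (iff_true_right hi).symm
  · rw [Formula.realize_not, Formula.realize_relabel, hx]
    exact (iff_false_right hi).symm

/-- The finite parts of the independence property transfer between models of a complete theory. -/
theorem HasIP.exists_finite_pattern {L : FirstOrder.Language.{u, v}} {M : Type w} [L.Structure M]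
    {N : Type*} [L.Structure N] [N ⊨ L.completeTheory M] {m n : ℕ}
    {φ : L.Formula (Fin m ⊕ Fin n)} (h : HasIP N φ) (k : ℕ) :
    ∃ (a : Fin k → Fin m → M) (b : Set (Fin k) → Fin n → M),
      ∀ i s, φ.Realize (Sum.elim (a i) (b s)) ↔ i ∈ s := by
  obtain ⟨a, b, hab⟩ := h
  have hN : ∃ x, (patternFormula φ k).Realize (M := N) x := by
    refine ⟨Sum.elim (fun c => a c.1 c.2) fun c => b (Fin.val '' c.1) c.2, ?_⟩
    refine (realize_patternFormula φ k _).2 fun i s => (hab i (Fin.val '' s)).trans ?_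
    exact Fin.val_injective.mem_set_image
  obtain ⟨x, hx⟩ := (exists_realize_iff (M := M) _).1 hN
  exact ⟨_, _, (realize_patternFormula φ k x).1 hx⟩

theorem isNIP_theory {R : Type u} [CommRing R] [LinearOrder R] [IsStrictOrderedRing R]
    [IsPrincipalIdealRing R] [DenselyOrdered R] (hR : IsDenseModule R R) : IsNIP (theory R) := by
  classical
  intro N m n φ hφ
  have hN : N ⊨ (lang R).completeTheory R := N.is_model
  obtain ⟨G, hG, hGφ⟩ := exists_finite_forall_agree hR hR φ
  have := hG.fintype
  obtain ⟨k, hk⟩ := exists_succ_pow_lt_two_pow (Fintype.card G)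
  obtain ⟨a, b, hab⟩ := hφ.exists_finite_pattern (M := R) k
  choose code hcode using fun A : G => exists_code_holds A.1 a b default
  have hinj : Function.Injective fun (s : Set (Fin k)) (A : G) => code A s := by
    intro s s' hss'
    ext i
    rw [← hab, ← hab]
    exact hGφ _ _ _ _ fun A hA => hcode ⟨A, hA⟩ s s' (congrFun hss' ⟨A, hA⟩) i
  have hcard := Fintype.card_le_of_injective _ hinj
  simp only [Fintype.card_set, Fintype.card_fin, Fintype.card_pi, Finset.prod_const,
    Finset.card_univ] at hcard
  exact absurd hcard (not_le.2 hk)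

end NIP

end OrdMod

theorem mainTheorem7 (R : Type u) [CommRing R] [LinearOrder R] [IsStrictOrderedRing R]
    [IsDomain R] [IsPrincipalIdealRing R] [DenselyOrdered R]
    (hdense : ∀ p : R, Prime p → OrdMod.DenseIn (Ideal.span {p} : Set R))
    (hinf : ∀ p : R, Prime p → Infinite (R ⧸ Ideal.span {p})) :
    (∀ (M : Type v) [AddCommGroup M] [LinearOrder M] [IsOrderedAddMonoid M] [Module R M]
        [Nontrivial M], (∀ (r : R) (m : M), 0 < r → 0 < m → 0 < r • m) →
        (M ⊨ OrdMod.theory R ↔ ∀ p : R, Prime p →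
          OrdMod.DenseIn (OrdMod.mulSub p M : Set M) ∧ Infinite (M ⧸ OrdMod.mulSub p M))) ∧
    OrdMod.ElimQuantifiers (OrdMod.theoryP R) ∧
    OrdMod.IsNIP (OrdMod.theory R) := by
  have hR := OrdMod.isDenseModule_self hdense hinf
  exact ⟨fun M _ _ _ _ _ hpos => OrdMod.model_theory_iff hR hpos,
    OrdMod.elimQuantifiers_theoryP hR, OrdMod.isNIP_theory hR⟩
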